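/- Let $V$ be a finite-dimensional Euclidean space with inner product $\langle\cdot,\cdot\rangle$ and norm $|\cdot|$ (used to identify $V^*$ with $V$). Let $X$ be a random variable with values in $V$, $Y$ a complex random variable on the same probability space with $\mathbb{E}|Y|^2<\infty$, and $\lambda>0$. Let $k_V(\omega)=k(|\omega|^2)$ with $k(r)>0$ for $r\ge 0$ and $\int_V k_V\,d\omega=1$. For a positive integrable weight $w$ on $V$ let $\mathcal H(w)$ be the Hilbert space of functions $f=\int \hat f(\omega)e^{2\pi i\langle \cdot,\omega\rangle}d\omega$ with $\|f\|_{\mathcal H(w)}^2=\int_V |\hat f|^2/w\,d\omega<\infty$. For $U\in\mathrm{End}(V)$ let $$J(U,\lambda)=\inf_{f\in\mathcal H(k_V)}\ \tfrac12\mathbb{E}|Y-f(UX)|^2+\tfrac{\lambda}{2}\|f\|^2_{\mathcal H(k_V)},$$ and for an inner product (positive definite symmetric bilinear form) $\Sigma$ on $V$ let $$\mathcal J(\Sigma;\lambda)=\inf_{F\in\mathcal H_\Sigma}\ \tfrac12\mathbb{E}|Y-F(X)|^2+\tfrac{\lambda}{2}\|F\|^2_{\mathcal H_\Sigma},\qquad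 \|F\|_{\mathcal H_\Sigma}^2=\sqrt{\det\Sigma}\int_V\frac{|\hat F(\omega)|^2}{k(|\omega|^2_{\Sigma^{-1}})}\,d\omega,$$ where $|\omega|_{\Sigma^{-1}}=\max_{|x|_\Sigma=1}\langle\omega,x\rangle$ is the dual norm (understood as $0$ if $V=0$) and $\det\Sigma$ is taken in an orthonormal basis of $V$. The partial compactification $\overline{Sym^2_{\ge0}}$ consists of the pairs $(W,\Sigma_W)$ of a linear subspace $W\subseteq V$ and a positive semidefinite symmetric form $\Sigma_W$ on $W$. The pairs with $W=V$ form the space $Sym^2_{\ge0}$ of positive semidefinite forms on $V$, and those with $W\ne V$ ($W=0$ allowed) are the points at infinity. A sequence $(W_i,\Sigma_i)$ is said to converge to $(W,\Sigma_W)$ if $W\subseteq W_i$ for all $i$, the restrictions $\Sigma_i|_W$ converge to $\Sigma_W$, and the quotient forms induced by $\Sigma_i$ on $W_i/W$ are bounded below by $\Lambda_i^2$ times the squared quotient norm induced by $|\cdot|$, for some $\Lambda_i\to+\infty$. (In particular, positive definite forms $\Sigma_i$ on $V$ converge to a point at infinity $(W,\Sigma_W)$ when $\Sigma_i|_W\to\Sigma_W$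 and the quotient forms on $V/W$ are bounded below by $\Lambda_i^2$ times the squared quotient norm, with $\Lambda_i\to+\infty$; and on $Sym^2_{\ge0}$ this is the usual convergence of forms.) A set is open if every sequence that converges to a point of the set is eventually in the set. Then $\mathcal J(\cdot\,;\lambda)$ extends to a continuous function on the partial compactification: there is a unique continuous function $\bar{\mathcal J}:\overline{Sym^2_{\ge0}}\to\mathbb R$ such that $\bar{\mathcal J}(\Sigma)=\mathcal J(\Sigma;\lambda)$ for every inner product $\Sigma$ on $V$ and $\bar{\mathcal J}(U^TU)=J(U,\lambda)$ for every $U\in\mathrm{End}(V)$, degenerate ones included. -/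

import Mathlib

open scoped FourierTransform Topology

noncomputable section

namespace KernelRidge

variable {V : Type*} [NormedAddCommGroup V] [InnerProductSpace ℝ V]

section Ridge

variable [FiniteDimensional ℝ V] [MeasurableSpace V] [BorelSpace V]

/-- `g` is a Fourier transform of `f` of finite weighted norm: `∫ |g|² / w < ∞`, and `f` is the
inverse Fourier transform of `g`. The dual of `V` is identified with `V` by the inner product.
For a positive integrable weight `w` such a `g` is integrable, by Cauchy-Schwarz. -/
def IsSpectrum (w : V → ℝ) (f g : V → ℂ) : Prop :=
  MeasureTheory.AEStronglyMeasurable g MeasureTheory.volume ∧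
    MeasureTheory.Integrable (fun ω => ‖g ω‖ ^ 2 / w ω) MeasureTheory.volume ∧
    ∀ x, f x = 𝓕⁻ g x

/-- The Hilbert space of functions `f` on `V` with `∫ |f̂|² / w < ∞`. -/
def rkhs (w : V → ℝ) : Set (V → ℂ) := {f | ∃ g, IsSpectrum w f g}

/-- The squared norm `∫ |f̂|² / w` of `f ∈ rkhs w`. The spectrum of `f` is unique up to null sets,
so that the infimum is over a single number. -/
def rkhsNormSq (w : V → ℝ) (f : V → ℂ) : ℝ :=
  sInf {r | ∃ g, IsSpectrum w f g ∧ r = ∫ ω, ‖g ω‖ ^ 2 / w ω}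

variable {Ω : Type*} [MeasurableSpace Ω]

/-- The loss `½ 𝔼|Y - f(X)|² + (λ/2) ‖f‖²`. -/
def loss (w : V → ℝ) (P : MeasureTheory.Measure Ω) (X : Ω → V) (Y : Ω → ℂ) (lam : ℝ)
    (f : V → ℂ) : ℝ :=
  1 / 2 * (∫ a, ‖Y a - f (X a)‖ ^ 2 ∂P) + lam / 2 * rkhsNormSq w f

/-- The infimum of the loss over the Hilbert space of weight `w`. -/
def ridgeValue (w : V → ℝ) (P : MeasureTheory.Measure Ω) (X : Ω → V) (Y : Ω → ℂ)
    (lam : ℝ) : ℝ :=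
  sInf (loss w P X Y lam '' rkhs w)

/-- The rotationally invariant weight `k_V(ω) = k(|ω|²)`. -/
def radialWeight (k : ℝ → ℝ) (ω : V) : ℝ := k (‖ω‖ ^ 2)

/-- `J(U, λ)`, the infimum over `f ∈ rkhs k_V` of `½ 𝔼|Y - f(UX)|² + (λ/2) ‖f‖²`. -/
def J (k : ℝ → ℝ) (P : MeasureTheory.Measure Ω) (X : Ω → V) (Y : Ω → ℂ) (lam : ℝ)
    (U : V →ₗ[ℝ] V) : ℝ :=
  ridgeValue (radialWeight k) P (fun a => U (X a)) Y lam

/-- The norm on the dual space that is dual to the norm of an inner product `S` on `V`. -/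
def dualNorm (S : LinearMap.BilinForm ℝ V) (ω : V) : ℝ :=
  sSup {t | ∃ x : V, S x x = 1 ∧ t = inner ℝ ω x}

/-- The determinant of `S` in an orthonormal basis of `V`. -/
def formDet (S : LinearMap.BilinForm ℝ V) : ℝ :=
  Matrix.det (Matrix.of fun i j =>
    S (stdOrthonormalBasis ℝ V i) (stdOrthonormalBasis ℝ V j))

/-- The weight of the space `ℋ_S`, whose squared norm is
`√(det S) ∫ |F̂(ω)|² / k(|ω|²_{S⁻¹}) dω`. -/
def formWeight (k : ℝ → ℝ) (S : LinearMap.BilinForm ℝ V) (ω : V) : ℝ :=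
  k (dualNorm S ω ^ 2) / √(formDet S)

/-- `𝒥(S; λ)` for an inner product `S`: the infimum over `F ∈ ℋ_S` of
`½ 𝔼|Y - F(X)|² + (λ/2) ‖F‖²`. -/
def calJ (k : ℝ → ℝ) (P : MeasureTheory.Measure Ω) (X : Ω → V) (Y : Ω → ℂ) (lam : ℝ)
    (S : LinearMap.BilinForm ℝ V) : ℝ :=
  ridgeValue (formWeight k S) P X Y lam

end Ridge

/-- Symmetric positive definite forms, the elements of `Sym²₊`. -/
def IsInnerProduct (S : LinearMap.BilinForm ℝ V) : Prop :=
  S.IsSymm ∧ ∀ x, x ≠ 0 → 0 < S x x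

theorem IsInnerProduct.isPosSemidef {S : LinearMap.BilinForm ℝ V} (h : IsInnerProduct S) :
    S.IsPosSemidef where
  isSymm := h.1
  isNonneg := ⟨fun x => by
    by_cases hx : x = 0
    · simp [hx]
    · exact (h.2 x hx).le⟩

/-- The form `UᵀU`, that is `(x, y) ↦ ⟨Ux, Uy⟩`. -/
def gram (U : V →ₗ[ℝ] V) : LinearMap.BilinForm ℝ V := (innerₗ V).compl₁₂ U U

theorem gram_apply (U : V →ₗ[ℝ] V) (x y : V) : gram U x y = inner ℝ (U x) (U y) := rfl

theorem gram_isPosSemidef (U : V →ₗ[ℝ] V) : (gram U).IsPosSemidef where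
  isSymm := ⟨fun x y => by simp [gram_apply, real_inner_comm]⟩
  isNonneg := ⟨fun x => real_inner_self_nonneg⟩

variable (V) in
/-- The partial compactification of `Sym²_{≥0}`: pairs `(W, Σ_W)` of a subspace `W` of `V` and a
positive semidefinite form on `W`. The pairs with `W = V` are the elements of `Sym²_{≥0}`, those
with `W ≠ V` are the points at infinity. -/
structure PartialCompactification where
  /-- the subspace `W` -/
  dom : Submodule ℝ V
  /-- the form `Σ_W` -/
  form : LinearMap.BilinForm ℝ dom
  isPosSemidef : form.IsPosSemidef

namespace PartialCompactification

/-- The inclusion of `Sym²_{≥0}`. -/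
def ofForm (S : LinearMap.BilinForm ℝ V) (hS : S.IsPosSemidef) : PartialCompactification V where
  dom := ⊤
  form := S.restrict ⊤
  isPosSemidef :=
    { isSymm := ⟨fun x y => hS.isSymm.eq x y⟩
      isNonneg := ⟨fun x => hS.isNonneg.nonneg x⟩ }

/-- The squared norm of the class of `x` for the quotient form that `p` induces modulo `W`. -/
def quotientSq (p : PartialCompactification V) (W : Submodule ℝ V) (x : p.dom) : ℝ :=
  ⨅ u : {u : p.dom // (u : V) ∈ W}, p.form (x + u) (x + u)

/-- Convergence of a sequence `q i = (W_i, Σ_i)` to `p = (W, Σ_W)`: the forms `Σ_i` are defined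
on `W`, their restrictions to `W` converge to `Σ_W`, and the quotient forms that they induce on
`W_i / W` are bounded below by `Λ_i²` times the background one, where `Λ_i → +∞`.
If all `W_i` are `V`, the quotient is `V / W`. If also `W = V`, this is convergence of forms. -/
def ConvergesTo (q : ℕ → PartialCompactification V) (p : PartialCompactification V) : Prop :=
  ∃ h : ∀ i, p.dom ≤ (q i).dom,
    (∀ x y : p.dom, Filter.Tendsto
      (fun i => (q i).form (Submodule.inclusion (h i) x) (Submodule.inclusion (h i) y))
      Filter.atTop (𝓝 (p.form x y))) ∧
    ∃ L : ℕ → ℝ, Filter.Tendsto L Filter.atTop Filter.atTop ∧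
      ∀ i, ∀ x : (q i).dom, L i ^ 2 * ‖p.dom.mkQ (x : V)‖ ^ 2 ≤ (q i).quotientSq p.dom x

/-- The topology of the above convergence of sequences: a set is open when every sequence that
converges to one of its points is eventually in it. -/
instance : TopologicalSpace (PartialCompactification V) where
  IsOpen O := ∀ q p, ConvergesTo q p → p ∈ O → ∀ᶠ i in Filter.atTop, q i ∈ O
  isOpen_univ _ _ _ _ := Filter.Eventually.of_forall fun _ => Set.mem_univ _
  isOpen_inter _ _ hs ht q p hq hp := (hs q p hq hp.1).and (ht q p hq hp.2)
  isOpen_sUnion _ hs q p hq hp := by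
    obtain ⟨t, ht, hpt⟩ := hp
    exact (hs t ht q p hq hpt).mono fun i hi => ⟨t, ht, hi⟩

theorem ConvergesTo.tendsto {q : ℕ → PartialCompactification V} {p : PartialCompactification V}
    (h : ConvergesTo q p) : Filter.Tendsto q Filter.atTop (𝓝 p) := by
  intro s hs
  obtain ⟨t, hts, ht, hpt⟩ := mem_nhds_iff.1 hs
  exact (ht q p h hpt).mono fun i hi => hts hi

end PartialCompactification

end KernelRidge

end

/-!
The ridge value of a positive integrable weight `w` depends on `w` only through the
translation-invariant kernel `h = 𝓕⁻ w`. Writing a function of the Hilbert space as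
`f(x) = ⟪φ x, u⟫` with `u ∈ L²(V)` and the feature map `φ x = √w · e^{-2πi⟨·, x⟩}`, the primal
problem becomes `inf_u ½ ‖Y - S u‖² + (λ/2) ‖u‖²` for the evaluation operator `S : L²(V) → L²(P)`
(`ridgeValue_eq_iInf`). Convex duality (`iInf_primal_eq_dualValue`) turns this into
`sup_g λ Re ⟪Y, g⟫ - (λ/2) ⟪g, T g⟫ - (λ²/2) ‖g‖²`, where `T = S S†` is the integral operator on
`L²(P)` with kernel `h (X a - X b)` (`ridgeValue_eq_dualValue`).

The kernel of a radial weight has the form `z ↦ κ (|z|²)` with `κ` continuous and, by the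
Riemann-Lebesgue lemma, `κ → 0` at infinity (`exists_profile`). For an inner product `Σ = AᵀA` the
change of variables `ω = Aᵀ v` shows that the kernel of `ℋ_Σ` is `z ↦ κ (Σ z z)`, and the kernel
that occurs in `J(U, λ)` is `z ↦ κ (|U z|²)`. Both are cases of the kernel of a point `(W, Σ_W)`:
`κ (Σ_W z z)` for `z ∈ W` and `0` otherwise. The extension is the dual value of this kernel.

If `(W_i, Σ_i)` converges to `(W, Σ_W)`, then the kernels converge pointwise: on `W` since `κ` is
continuous, and off `W` since there the forms tend to infinity
(`PartialCompactification.ConvergesTo.tendsto_profileKernel`). By bounded convergence the integral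
operators converge in Hilbert-Schmidt norm, and the dual value is Lipschitz in the operator as long
as the operators are positive (`dualValue_le_add`). Positivity at all points, and uniqueness of the
extension, hold because every point is a limit of inner products
(`PartialCompactification.convergesTo_regularization`).
-/

noncomputable section

open MeasureTheory Filter
open scoped Matrix

namespace KernelRidge

/-! ### Duality for ridge regression in Hilbert spaces -/

section Duality

variable {E : Type*} [NormedAddCommGroup E] [InnerProductSpace ℂ E]

/-- The objective of the dual problem, with `Q g` in place of `⟪g, T g⟫` for the kernel
operator `T`. -/
def dualObjective (y : E) (lam : ℝ) (Q : E → ℝ) (g : E) : ℝ :=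
  lam * (inner ℂ y g).re - lam / 2 * Q g - lam ^ 2 / 2 * ‖g‖ ^ 2

/-- The value of the dual problem, which for `Q g = ⟪g, T g⟫` is `(λ/2) ⟪y, (T + λ)⁻¹ y⟫`. -/
def dualValue (y : E) (lam : ℝ) (Q : E → ℝ) : ℝ := ⨆ g, dualObjective y lam Q g

theorem dualObjective_le (y : E) {lam : ℝ} (hlam : 0 < lam) {Q : E → ℝ} (hQ : ∀ g, 0 ≤ Q g)
    (g : E) : dualObjective y lam Q g ≤ lam * (‖y‖ * ‖g‖) - lam ^ 2 / 2 * ‖g‖ ^ 2 := by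
  have h1 : (inner ℂ y g).re ≤ ‖y‖ * ‖g‖ := re_inner_le_norm (𝕜 := ℂ) y g
  have h2 := mul_le_mul_of_nonneg_left h1 hlam.le
  have h3 := mul_nonneg (half_pos hlam).le (hQ g)
  unfold dualObjective
  linarith

theorem bddAbove_range_dualObjective (y : E) {lam : ℝ} (hlam : 0 < lam) {Q : E → ℝ}
    (hQ : ∀ g, 0 ≤ Q g) : BddAbove (Set.range (dualObjective y lam Q)) := by
  refine ⟨‖y‖ ^ 2 / 2, ?_⟩
  rintro _ ⟨g, rfl⟩
  have := dualObjective_le y hlam hQ g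
  nlinarith [sq_nonneg (‖y‖ - lam * ‖g‖)]

/-- Only vectors `g` with `‖g‖ ≤ 2‖y‖/λ` compete in the dual problem, as the others do worse than
`g = 0`. Hence the dual value is Lipschitz in `Q` for the norm of quadratic forms. -/
theorem dualValue_le_add (y : E) {lam : ℝ} (hlam : 0 < lam) {Q Q' : E → ℝ}
    (hQ : ∀ g, 0 ≤ Q g) (hQ' : ∀ g, 0 ≤ Q' g) (h0 : Q' 0 = 0) {δ : ℝ} (hδ : 0 ≤ δ)
    (h : ∀ g, |Q g - Q' g| ≤ δ * ‖g‖ ^ 2) :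
    dualValue y lam Q ≤ dualValue y lam Q' + lam / 2 * (δ * (2 * ‖y‖ / lam) ^ 2) := by
  refine ciSup_le fun g => ?_
  have hb := bddAbove_range_dualObjective y hlam hQ'
  by_cases hg : dualObjective y lam Q g ≤ 0
  · have h1 : dualObjective y lam Q' 0 ≤ dualValue y lam Q' := le_ciSup hb 0
    have h2 : dualObjective y lam Q' 0 = 0 := by simp [dualObjective, h0]
    have : 0 ≤ lam / 2 * (δ * (2 * ‖y‖ / lam) ^ 2) := by positivity
    linarith
  · have h1 : dualObjective y lam Q' g ≤ dualValue y lam Q' := le_ciSup hb g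
    have hle : ‖g‖ ≤ 2 * ‖y‖ / lam := by
      have h2 := dualObjective_le y hlam hQ g
      rw [le_div_iff₀ hlam]
      by_contra! hlt
      have h3 : 0 ≤ lam * ‖g‖ := by positivity
      nlinarith
    have h3 : δ * ‖g‖ ^ 2 ≤ δ * (2 * ‖y‖ / lam) ^ 2 := by gcongr
    have h4 := mul_le_mul_of_nonneg_left
      (((neg_le_abs _).trans (h g)).trans h3) (half_pos hlam).le
    unfold dualObjective at *
    linarith

theorem tendsto_dualValue (y : E) {lam : ℝ} (hlam : 0 < lam) {Q : ℕ → E → ℝ} {Q' : E → ℝ}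
    (hQ : ∀ i g, 0 ≤ Q i g) (hQ' : ∀ g, 0 ≤ Q' g) (h0 : ∀ i, Q i 0 = 0) (h0' : Q' 0 = 0)
    {δ : ℕ → ℝ} (hδ : ∀ i, 0 ≤ δ i) (hδ0 : Tendsto δ atTop (𝓝 0))
    (h : ∀ i g, |Q i g - Q' g| ≤ δ i * ‖g‖ ^ 2) :
    Tendsto (fun i => dualValue y lam (Q i)) atTop (𝓝 (dualValue y lam Q')) := by
  have hlim : Tendsto (fun i => lam / 2 * (δ i * (2 * ‖y‖ / lam) ^ 2)) atTop (𝓝 0) := by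
    simpa using (hδ0.mul_const ((2 * ‖y‖ / lam) ^ 2)).const_mul (lam / 2)
  refine tendsto_of_tendsto_of_tendsto_of_le_of_le
    (g := fun i => dualValue y lam Q' - lam / 2 * (δ i * (2 * ‖y‖ / lam) ^ 2))
    (h := fun i => dualValue y lam Q' + lam / 2 * (δ i * (2 * ‖y‖ / lam) ^ 2))
    (by simpa using hlim.const_sub (dualValue y lam Q'))
    (by simpa using hlim.const_add (dualValue y lam Q')) (fun i => ?_) (fun i => ?_)
  · have := dualValue_le_add y hlam hQ' (hQ i) (h0 i) (hδ i)
      (fun g => by rw [abs_sub_comm]; exact h i g)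
    simp only
    linarith
  · exact dualValue_le_add y hlam (hQ i) hQ' h0' (hδ i) (h i)

variable [CompleteSpace E] {H : Type*} [NormedAddCommGroup H] [InnerProductSpace ℂ H]
  [CompleteSpace H]

/-- The normal equation of ridge regression is solvable, since `S†S + λ` is coercive. -/
theorem exists_normal_equation (S : H →L[ℂ] E) (y : E) {lam : ℝ} (hlam : 0 < lam) :
    ∃ f : H, S.adjoint (y - S f) = (lam : ℂ) • f := by
  have hu : IsUnit (S.adjoint ∘L S + (lam : ℂ) • ContinuousLinearMap.id ℂ H) := by
    refine ContinuousLinearMap.isUnit_of_forall_le_norm_inner_map _ (c := ⟨lam, hlam.le⟩) hlam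
      fun x => le_trans ?_ (Complex.re_le_norm _)
    have h1 : inner ℂ ((S.adjoint ∘L S + (lam : ℂ) • ContinuousLinearMap.id ℂ H) x) x
        = ((‖S x‖ ^ 2 + lam * ‖x‖ ^ 2 : ℝ) : ℂ) := by
      simp [ContinuousLinearMap.adjoint_inner_left, inner_self_eq_norm_sq_to_K]
    rw [h1, Complex.ofReal_re]
    change ‖x‖ ^ 2 * lam ≤ _
    nlinarith [sq_nonneg ‖S x‖]
  obtain ⟨f, hf⟩ := (ContinuousLinearMap.isUnit_iff_bijective.1 hu).2 (S.adjoint y)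
  refine ⟨f, ?_⟩
  simp at hf
  rw [map_sub, ← hf]
  abel

/-- Weak duality. -/
theorem dualObjective_le_primal (S : H →L[ℂ] E) (y : E) {lam : ℝ} (hlam : 0 < lam) (f : H)
    (g : E) : dualObjective y lam (fun g => ‖S.adjoint g‖ ^ 2) g ≤
      1 / 2 * ‖y - S f‖ ^ 2 + lam / 2 * ‖f‖ ^ 2 := by
  have h1 : (inner ℂ (y - S f) g).re ≤ ‖y - S f‖ * ‖g‖ := re_inner_le_norm (𝕜 := ℂ) _ g
  have h2 : (inner ℂ f (S.adjoint g)).re ≤ ‖f‖ * ‖S.adjoint g‖ := re_inner_le_norm (𝕜 := ℂ) _ _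
  rw [ContinuousLinearMap.adjoint_inner_right] at h2
  rw [inner_sub_left, Complex.sub_re] at h1
  unfold dualObjective
  nlinarith [sq_nonneg (‖y - S f‖ - lam * ‖g‖), sq_nonneg (‖f‖ - ‖S.adjoint g‖)]

/-- The primal and the dual problem have the same value: both are attained, at the solution `f`
of the normal equation and at `g = λ⁻¹ (y - S f)`. -/
theorem iInf_primal_eq_dualValue (S : H →L[ℂ] E) (y : E) {lam : ℝ} (hlam : 0 < lam) :
    ⨅ f : H, (1 / 2 * ‖y - S f‖ ^ 2 + lam / 2 * ‖f‖ ^ 2) =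
      dualValue y lam fun g => ‖S.adjoint g‖ ^ 2 := by
  have hb := bddAbove_range_dualObjective y hlam (Q := fun g => ‖S.adjoint g‖ ^ 2)
    fun g => sq_nonneg _
  apply le_antisymm
  · obtain ⟨f, hf⟩ := exists_normal_equation S y hlam
    refine (ciInf_le ⟨0, ?_⟩ f).trans (le_trans (le_of_eq ?_)
      (le_ciSup hb ((lam : ℂ)⁻¹ • (y - S f))))
    · rintro _ ⟨f, rfl⟩
      positivity
    have hl : (lam : ℂ) ≠ 0 := by exact_mod_cast hlam.ne'
    have h1 : S.adjoint ((lam : ℂ)⁻¹ • (y - S f)) = f := by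
      rw [map_smul, hf, smul_smul, inv_mul_cancel₀ hl, one_smul]
    have h2 : (inner ℂ (S f) (y - S f)).re = lam * ‖f‖ ^ 2 := by
      rw [← ContinuousLinearMap.adjoint_inner_right, hf, inner_smul_right,
        inner_self_eq_norm_sq_to_K, Complex.re_ofReal_mul]
      norm_cast
    have h3 : (inner ℂ y (y - S f)).re = ‖y - S f‖ ^ 2 + lam * ‖f‖ ^ 2 := by
      rw [← h2, ← sub_eq_iff_eq_add, ← Complex.sub_re, ← inner_sub_left,
        inner_self_eq_norm_sq_to_K]
      norm_cast
    have h4 : (inner ℂ y ((lam : ℂ)⁻¹ • (y - S f))).re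
        = lam⁻¹ * (‖y - S f‖ ^ 2 + lam * ‖f‖ ^ 2) := by
      rw [inner_smul_right, ← Complex.ofReal_inv, Complex.re_ofReal_mul, h3]
    have h5 : ‖(lam : ℂ)⁻¹ • (y - S f)‖ = lam⁻¹ * ‖y - S f‖ := by
      rw [norm_smul, norm_inv, Complex.norm_real, Real.norm_of_nonneg hlam.le]
    simp only [dualObjective, h1, h4, h5]
    field_simp
    ring
  · exact ciSup_le fun g => le_ciInf fun f => dualObjective_le_primal S y hlam f g

end Duality

/-! ### Translation-invariant kernels on a probability space -/

section KernelForm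

variable {V : Type*} [NormedAddCommGroup V] {Ω : Type*} [MeasurableSpace Ω] (P : Measure Ω)
  (X : Ω → V)

/-- The quadratic form `⟪g, T g⟫` of the integral operator `T` on `L²(P)` whose kernel is
`h (X a - X b)`. -/
def kernelForm (h : V → ℂ) (g : Lp ℂ 2 P) : ℝ :=
  (∫ p : Ω × Ω, (starRingEnd ℂ (g p.1) * g p.2) * h (X p.1 - X p.2) ∂(P.prod P)).re

theorem kernelForm_zero [IsProbabilityMeasure P] (h : V → ℂ) : kernelForm P X h 0 = 0 := by
  simp [kernelForm]

theorem norm_sq_Lp (g : Lp ℂ 2 P) : ‖g‖ ^ 2 = ∫ a, ‖g a‖ ^ 2 ∂P := by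
  rw [← inner_self_eq_norm_sq (𝕜 := ℂ) g, L2.inner_def, ← integral_re (L2.integrable_inner g g)]
  simp only [inner_self_eq_norm_sq]

theorem memLp_conj_mul (g : Lp ℂ 2 P) :
    MemLp (fun p : Ω × Ω => starRingEnd ℂ (g p.1) * g p.2) 2 (P.prod P) := by
  have hm : AEStronglyMeasurable (fun p : Ω × Ω => starRingEnd ℂ (g p.1) * g p.2) (P.prod P) :=
    (RCLike.continuous_conj.comp_aestronglyMeasurable (Lp.aestronglyMeasurable g).comp_fst).mul
      (Lp.aestronglyMeasurable g).comp_snd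
  rw [memLp_two_iff_integrable_sq_norm hm]
  have := (memLp_two_iff_integrable_sq_norm (Lp.aestronglyMeasurable g)).1 (Lp.memLp g)
  simpa [mul_pow] using this.mul_prod this

theorem integral_norm_sq_conj_mul [SFinite P] (g : Lp ℂ 2 P) :
    ∫ p : Ω × Ω, ‖starRingEnd ℂ (g p.1) * g p.2‖ ^ 2 ∂(P.prod P) = (‖g‖ ^ 2) ^ 2 := by
  rw [norm_sq_Lp, sq (∫ a, _ ∂P), ← integral_prod_mul]
  simp [mul_pow]

variable {X} [MeasurableSpace V] [BorelSpace V] [IsProbabilityMeasure P]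

section Evaluation

variable {H : Type*} [NormedAddCommGroup H] [InnerProductSpace ℂ H]

theorem memLp_inner_feature (hX : Measurable X) {φ : V → H} (hφ : Continuous φ) {C : ℝ}
    (hC : ∀ x, ‖φ x‖ ≤ C) (f : H) : MemLp (fun a => inner ℂ (φ (X a)) f) 2 P :=
  MemLp.of_bound ((hφ.inner continuous_const).measurable.comp hX).aestronglyMeasurable
    (C * ‖f‖) (ae_of_all _ fun _ => (norm_inner_le_norm _ _).trans
      (mul_le_mul_of_nonneg_right (hC _) (norm_nonneg _)))

/-- The evaluation operator `f ↦ f(X)` from a Hilbert space of functions with feature map `φ`,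
`f(x) = ⟪φ x, f⟫`, to `L²(P)`. -/
def evalOp (hX : Measurable X) {φ : V → H} (hφ : Continuous φ) {C : ℝ} (hC : ∀ x, ‖φ x‖ ≤ C) :
    H →L[ℂ] Lp ℂ 2 P :=
  LinearMap.mkContinuous
    { toFun := fun f => (memLp_inner_feature P hX hφ hC f).toLp
      map_add' := fun f f' => by
        rw [← MemLp.toLp_add]
        simp [Pi.add_def]
      map_smul' := fun c f => by
        rw [RingHom.id_apply, ← MemLp.toLp_const_smul]
        simp [Pi.smul_def] } C fun f => by
    have hC0 : 0 ≤ C := (norm_nonneg _).trans (hC 0)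
    have hb : ∀ᵐ a ∂P, ‖(memLp_inner_feature P hX hφ hC f).toLp _ a‖ ≤ C * ‖f‖ := by
      filter_upwards [(memLp_inner_feature P hX hφ hC f).coeFn_toLp] with a ha
      rw [ha]
      exact (norm_inner_le_norm _ _).trans (mul_le_mul_of_nonneg_right (hC _) (norm_nonneg _))
    have := Lp.norm_le_of_ae_bound (p := 2) (by positivity) hb
    simpa only [measureUnivNNReal, measure_univ, ENNReal.toNNReal_one, NNReal.coe_one,
      Real.one_rpow, one_mul] using! this

theorem evalOp_ae (hX : Measurable X) {φ : V → H} (hφ : Continuous φ) {C : ℝ}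
    (hC : ∀ x, ‖φ x‖ ≤ C) (f : H) :
    evalOp P hX hφ hC f =ᵐ[P] fun a => inner ℂ (φ (X a)) f :=
  (memLp_inner_feature P hX hφ hC f).coeFn_toLp

end Evaluation

variable [SecondCountableTopology V]

theorem memLp_kernel (hX : Measurable X) {h : V → ℂ} (hm : Measurable h) {C : ℝ}
    (hC : ∀ z, ‖h z‖ ≤ C) :
    MemLp (fun p : Ω × Ω => h (X p.1 - X p.2)) 2 (P.prod P) :=
  MemLp.of_bound (hm.comp ((hX.comp measurable_fst).sub
    (hX.comp measurable_snd))).aestronglyMeasurable C (ae_of_all _ fun _ => hC _)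

theorem integrable_conj_mul_kernel (hX : Measurable X) {h : V → ℂ} (hm : Measurable h) {C : ℝ}
    (hC : ∀ z, ‖h z‖ ≤ C) (g : Lp ℂ 2 P) :
    Integrable (fun p : Ω × Ω => (starRingEnd ℂ (g p.1) * g p.2) * h (X p.1 - X p.2))
      (P.prod P) :=
  (memLp_conj_mul P g).integrable_mul (memLp_kernel P hX hm hC)

/-- The Hilbert-Schmidt bound for the difference of two kernels. -/
theorem abs_kernelForm_sub_le (hX : Measurable X) {h h' : V → ℂ} (hm : Measurable h)
    (hm' : Measurable h') {C : ℝ} (hC : ∀ z, ‖h z‖ ≤ C) (hC' : ∀ z, ‖h' z‖ ≤ C) (g : Lp ℂ 2 P) :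
    |kernelForm P X h g - kernelForm P X h' g| ≤
      √(∫ p : Ω × Ω, ‖h (X p.1 - X p.2) - h' (X p.1 - X p.2)‖ ^ 2 ∂(P.prod P)) * ‖g‖ ^ 2 := by
  have hg := memLp_conj_mul P g
  have hd := (memLp_kernel P hX hm hC).sub (memLp_kernel P hX hm' hC')
  rw [kernelForm, kernelForm, ← Complex.sub_re, ← integral_sub
    (integrable_conj_mul_kernel P hX hm hC g) (integrable_conj_mul_kernel P hX hm' hC' g)]
  refine (Complex.abs_re_le_norm _).trans ((norm_integral_le_integral_norm _).trans ?_)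
  have hhol := integral_mul_norm_le_Lp_mul_Lq (f := fun p : Ω × Ω => starRingEnd ℂ (g p.1) * g p.2)
    (g := fun p : Ω × Ω => h (X p.1 - X p.2) - h' (X p.1 - X p.2)) (μ := P.prod P)
    Real.HolderConjugate.two_two (by simpa using hg) (by simpa [Pi.sub_def] using hd)
  simp only [Real.rpow_two, ← Real.sqrt_eq_rpow, integral_norm_sq_conj_mul] at hhol
  rw [Real.sqrt_sq (by positivity), mul_comm] at hhol
  refine le_trans (le_of_eq ?_) hhol
  congr 1
  ext p
  rw [← mul_sub, norm_mul]

/-- If bounded kernels converge pointwise, their integral operators converge in Hilbert-Schmidt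
norm, so that the dual values converge. -/
theorem tendsto_dualValue_kernelForm (hX : Measurable X) (y : Lp ℂ 2 P) {lam : ℝ}
    (hlam : 0 < lam) {h : ℕ → V → ℂ} {h' : V → ℂ} (hm : ∀ i, Measurable (h i))
    (hm' : Measurable h') {C : ℝ} (hC : ∀ i z, ‖h i z‖ ≤ C) (hC' : ∀ z, ‖h' z‖ ≤ C)
    (hpos : ∀ i g, 0 ≤ kernelForm P X (h i) g) (hpos' : ∀ g, 0 ≤ kernelForm P X h' g)
    (hlim : ∀ z, Tendsto (fun i => h i z) atTop (𝓝 (h' z))) :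
    Tendsto (fun i => dualValue y lam (kernelForm P X (h i))) atTop
      (𝓝 (dualValue y lam (kernelForm P X h'))) := by
  refine tendsto_dualValue y hlam hpos hpos' (fun i => kernelForm_zero P X _)
    (kernelForm_zero P X _) (fun i => Real.sqrt_nonneg _) ?_
    (fun i g => abs_kernelForm_sub_le P hX (hm i) hm' (hC i) hC' g)
  rw [← Real.sqrt_zero]
  refine (Real.continuous_sqrt.tendsto 0).comp ?_
  rw [← integral_zero (Ω × Ω) ℝ (μ := P.prod P)]
  refine tendsto_integral_of_dominated_convergence (fun _ => (C + C) ^ 2) (fun i => ?_)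
    (integrable_const _) (fun i => ae_of_all _ fun p => ?_) (ae_of_all _ fun p => ?_)
  · exact (((memLp_kernel P hX (hm i) (hC i)).sub
      (memLp_kernel P hX hm' hC')).aestronglyMeasurable.norm.pow 2)
  · rw [Real.norm_of_nonneg (by positivity)]
    gcongr
    exact (norm_sub_le _ _).trans (add_le_add (hC i _) (hC' _))
  · have := ((hlim (X p.1 - X p.2)).sub_const (h' (X p.1 - X p.2))).norm.pow 2
    simpa using this

/-- Positivity of integral operators passes to pointwise limits of bounded kernels. -/
theorem kernelForm_nonneg_of_tendsto (hX : Measurable X) {h : ℕ → V → ℂ} {h' : V → ℂ}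
    (hm : ∀ i, Measurable (h i)) {C : ℝ} (hC : ∀ i z, ‖h i z‖ ≤ C)
    (hlim : ∀ z, Tendsto (fun i => h i z) atTop (𝓝 (h' z))) (g : Lp ℂ 2 P)
    (hpos : ∀ i, 0 ≤ kernelForm P X (h i) g) : 0 ≤ kernelForm P X h' g := by
  refine ge_of_tendsto' ((Complex.continuous_re.tendsto _).comp
    (tendsto_integral_of_dominated_convergence
      (fun p : Ω × Ω => ‖starRingEnd ℂ (g p.1) * g p.2‖ * C) (fun i => ?_) ?_
      (fun i => ae_of_all _ fun p => ?_) (ae_of_all _ fun p => ?_))) hpos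
  · exact (integrable_conj_mul_kernel P hX (hm i) (hC i) g).aestronglyMeasurable
  · exact ((memLp_conj_mul P g).integrable one_le_two).norm.mul_const C
  · rw [norm_mul]
    exact mul_le_mul_of_nonneg_left (hC i _) (norm_nonneg _)
  · exact (hlim _).const_mul _

variable {H : Type*} [NormedAddCommGroup H] [InnerProductSpace ℂ H]

theorem integrable_smul_feature (hX : Measurable X) {φ : V → H} (hφ : Continuous φ) {C : ℝ}
    (hC : ∀ x, ‖φ x‖ ≤ C) (g : Lp ℂ 2 P) : Integrable (fun a => g a • φ (X a)) P := by
  have hsm : AEStronglyMeasurable (fun a => φ (X a)) P :=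
    (hφ.comp_stronglyMeasurable hX.stronglyMeasurable).aestronglyMeasurable
  exact ((Lp.memLp g).integrable one_le_two).smul_bdd C hsm (ae_of_all _ fun a => hC _)

variable [CompleteSpace H]

/-- The adjoint of the evaluation operator is `g ↦ 𝔼 g φ(X)`. -/
theorem adjoint_evalOp (hX : Measurable X) {φ : V → H} (hφ : Continuous φ) {C : ℝ}
    (hC : ∀ x, ‖φ x‖ ≤ C) (g : Lp ℂ 2 P) :
    (evalOp P hX hφ hC).adjoint g = ∫ a, g a • φ (X a) ∂P := by
  refine ext_inner_left ℂ fun f => ?_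
  rw [ContinuousLinearMap.adjoint_inner_right, L2.inner_def,
    ← integral_inner (integrable_smul_feature P hX hφ hC g)]
  refine integral_congr_ae ?_
  filter_upwards [evalOp_ae P hX hφ hC f] with a ha
  rw [ha, inner_smul_right]
  simp

/-- For a feature map with kernel `h (x - x')`, the operator `S S†` is the integral operator of
`kernelForm`. -/
theorem norm_sq_adjoint_evalOp (hX : Measurable X) {φ : V → H} (hφ : Continuous φ) {C : ℝ}
    (hC : ∀ x, ‖φ x‖ ≤ C) {h : V → ℂ} (hh : ∀ x x', inner ℂ (φ x) (φ x') = h (x - x'))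
    (hm : Measurable h) (g : Lp ℂ 2 P) :
    ‖(evalOp P hX hφ hC).adjoint g‖ ^ 2 = kernelForm P X h g := by
  have hhC : ∀ z, ‖h z‖ ≤ C * C := fun z => by
    rw [← sub_zero z, ← hh]
    exact (norm_inner_le_norm _ _).trans
      (mul_le_mul (hC _) (hC _) (norm_nonneg _) ((norm_nonneg _).trans (hC 0)))
  have hi := integrable_smul_feature P hX hφ hC g
  rw [← inner_self_eq_norm_sq (𝕜 := ℂ), kernelForm,
    integral_prod _ (integrable_conj_mul_kernel P hX hm hhC g), adjoint_evalOp,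
    ← inner_conj_symm, ← integral_inner hi,
    ← integral_conj]
  change Complex.re _ = _
  congr 2
  ext a
  rw [inner_conj_symm, inner_smul_left, ← integral_inner hi, ← integral_const_mul]
  congr 1
  ext b
  rw [inner_smul_right, hh, mul_assoc]

theorem iInf_ridge_eq_dualValue (hX : Measurable X) {φ : V → H} (hφ : Continuous φ) {C : ℝ}
    (hC : ∀ x, ‖φ x‖ ≤ C) {h : V → ℂ} (hh : ∀ x x', inner ℂ (φ x) (φ x') = h (x - x'))
    (hm : Measurable h) {Y : Ω → ℂ} (hY : MemLp Y 2 P) {lam : ℝ} (hlam : 0 < lam) :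
    ⨅ f : H, (1 / 2 * (∫ a, ‖Y a - inner ℂ (φ (X a)) f‖ ^ 2 ∂P) + lam / 2 * ‖f‖ ^ 2) =
      dualValue hY.toLp lam (kernelForm P X h) := by
  have hQ : kernelForm P X h = fun g => ‖(evalOp P hX hφ hC).adjoint g‖ ^ 2 :=
    funext fun g => (norm_sq_adjoint_evalOp P hX hφ hC hh hm g).symm
  rw [hQ, ← iInf_primal_eq_dualValue _ _ hlam]
  congr 1
  ext f
  rw [norm_sq_Lp]
  congr 2
  refine integral_congr_ae ?_
  filter_upwards [hY.coeFn_toLp, evalOp_ae P hX hφ hC f,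
    Lp.coeFn_sub hY.toLp (evalOp P hX hφ hC f)] with a h1 h2 h3
  rw [h3, Pi.sub_apply, h1, h2]

end KernelForm

/-! ### Function spaces with a spectral weight -/

section Feature

variable {V : Type*} [NormedAddCommGroup V] [InnerProductSpace ℝ V] [FiniteDimensional ℝ V]
  [MeasurableSpace V] [BorelSpace V]

/-- The translation-invariant kernel of the Hilbert space of weight `w`. -/
def weightKernel (w : V → ℝ) : V → ℂ := 𝓕⁻ fun v => (w v : ℂ)

theorem continuous_weightKernel {w : V → ℝ} (hw : Integrable w) : Continuous (weightKernel w) := by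
  have h : ∀ z, weightKernel w z = ∫ v, Real.fourierChar (inner ℝ v z) • (w v : ℂ) :=
    Real.fourierInv_eq _
  simp only [funext h, continuous_iff_continuousAt, ContinuousAt]
  intro z
  refine tendsto_integral_filter_of_dominated_convergence (fun v => ‖w v‖)
    (Eventually.of_forall fun z' => ?_)
    (Eventually.of_forall fun z' => ae_of_all _ fun v => by simp [Circle.norm_smul]) hw.norm
    (ae_of_all _ fun v => ?_)
  · have hc : Continuous fun v : V => (Real.fourierChar (inner ℝ v z') : Circle) :=
      Real.continuous_fourierChar.comp (by fun_prop)
    exact hc.aestronglyMeasurable.smul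
      (Complex.continuous_ofReal.comp_aestronglyMeasurable hw.aestronglyMeasurable)
  · have hc : Continuous fun z' : V => Real.fourierChar (inner ℝ v z') • (w v : ℂ) :=
      (Real.continuous_fourierChar.comp (by fun_prop)).smul continuous_const
    exact hc.tendsto z

theorem norm_weightKernel_le (w : V → ℝ) (z : V) : ‖weightKernel w z‖ ≤ ∫ v, ‖w v‖ := by
  rw [weightKernel, Real.fourierInv_eq]
  refine (norm_integral_le_integral_norm _).trans (le_of_eq ?_)
  simp [Circle.norm_smul]

theorem tendsto_weightKernel_cocompact (w : V → ℝ) :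
    Tendsto (weightKernel w) (cocompact V) (𝓝 0) := by
  have h := (tendsto_integral_exp_inner_smul_cocompact fun v : V => (w v : ℂ)).comp
    (Homeomorph.neg V).isClosedEmbedding.tendsto_cocompact
  refine h.congr fun z => ?_
  simp [weightKernel, Real.fourierInv_eq]

variable {w : V → ℝ}

theorem memLp_feature (hpos : ∀ v, 0 < w v) (hw : Integrable w) (x : V) :
    MemLp (fun v => Real.fourierChar (-inner ℝ v x) • (√(w v) : ℂ)) 2 volume := by
  have hc : Continuous fun v : V => (Real.fourierChar (-inner ℝ v x) : Circle) :=
    Real.continuous_fourierChar.comp (by fun_prop)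
  rw [memLp_two_iff_integrable_sq_norm]
  · refine hw.congr (ae_of_all _ fun v => ?_)
    simp [Circle.norm_smul, Real.sq_sqrt (hpos v).le]
  · exact hc.aestronglyMeasurable.smul (Complex.continuous_ofReal.comp_aestronglyMeasurable
      (Real.continuous_sqrt.comp_aestronglyMeasurable hw.aestronglyMeasurable))

/-- The feature map of the Hilbert space of weight `w`, identified with `L²(V)` by
`u ↦ 𝓕⁻ (√w u)`. -/
def feature (hpos : ∀ v, 0 < w v) (hw : Integrable w) (x : V) : Lp ℂ 2 (volume : Measure V) :=
  (memLp_feature hpos hw x).toLp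

theorem inner_feature (hpos : ∀ v, 0 < w v) (hw : Integrable w) (x : V)
    (u : Lp ℂ 2 (volume : Measure V)) :
    inner ℂ (feature hpos hw x) u = 𝓕⁻ (fun v => (√(w v) : ℂ) * u v) x := by
  rw [L2.inner_def, Real.fourierInv_eq]
  refine integral_congr_ae ?_
  filter_upwards [(memLp_feature hpos hw x).coeFn_toLp] with v hv
  rw [feature, hv]
  simp [Circle.smul_def, ← Circle.coe_inv_eq_conj, AddChar.map_neg_eq_inv]
  ring

theorem inner_feature_feature (hpos : ∀ v, 0 < w v) (hw : Integrable w) (x x' : V) :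
    inner ℂ (feature hpos hw x) (feature hpos hw x') = weightKernel w (x - x') := by
  rw [inner_feature, weightKernel, Real.fourierInv_eq, Real.fourierInv_eq]
  refine integral_congr_ae ?_
  filter_upwards [(memLp_feature hpos hw x').coeFn_toLp] with v hv
  rw [feature, hv, inner_sub_right, sub_eq_add_neg, AddChar.map_add_eq_mul, mul_smul]
  congr 1
  rw [mul_smul_comm, ← Complex.ofReal_mul, Real.mul_self_sqrt (hpos v).le]

theorem norm_feature_sq (hpos : ∀ v, 0 < w v) (hw : Integrable w) (x : V) :
    ‖feature hpos hw x‖ ^ 2 = (weightKernel w 0).re := by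
  rw [← inner_self_eq_norm_sq (𝕜 := ℂ), inner_feature_feature, sub_self]
  rfl

theorem norm_feature_le (hpos : ∀ v, 0 < w v) (hw : Integrable w) (x : V) :
    ‖feature hpos hw x‖ ≤ √(weightKernel w 0).re :=
  Real.le_sqrt_of_sq_le (norm_feature_sq hpos hw x).le

/-- Expanding the square, `‖φ x - φ z‖² = 2 (h 0 - Re h (x - z))` for the kernel `h`, which is
continuous. -/
theorem continuous_feature (hpos : ∀ v, 0 < w v) (hw : Integrable w) :
    Continuous (feature hpos hw) := by
  have hsq : ∀ x z, ‖feature hpos hw x - feature hpos hw z‖ ^ 2 =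
      2 * ((weightKernel w 0).re - (weightKernel w (x - z)).re) := fun x z => by
    rw [@norm_sub_sq ℂ, norm_feature_sq, norm_feature_sq, inner_feature_feature]
    change _ - 2 * (weightKernel w (x - z)).re + _ = _
    ring
  refine continuous_iff_continuousAt.2 fun z => tendsto_iff_norm_sub_tendsto_zero.2 ?_
  have hc : Continuous fun x => 2 * ((weightKernel w 0).re - (weightKernel w (x - z)).re) := by
    have := continuous_weightKernel hw
    fun_prop
  have h := (Real.continuous_sqrt.comp hc).tendsto z
  simp only [Function.comp_def, ← hsq, Real.sqrt_sq (norm_nonneg _)] at h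
  simpa using h

variable {Ω : Type*} [MeasurableSpace Ω] (P : Measure Ω)

/-- Every `u ∈ L²(V)` is the coordinate vector of a function in the Hilbert space of weight `w`,
with spectrum `√w u`. -/
theorem isSpectrum_of_Lp (hpos : ∀ v, 0 < w v) (hw : Integrable w)
    (u : Lp ℂ 2 (volume : Measure V)) :
    IsSpectrum w (fun x => inner ℂ (feature hpos hw x) u) (fun v => (√(w v) : ℂ) * u v) ∧
      ∫ v, ‖(√(w v) : ℂ) * u v‖ ^ 2 / w v = ‖u‖ ^ 2 := by
  have h : (fun v => ‖(√(w v) : ℂ) * u v‖ ^ 2 / w v) = fun v => ‖u v‖ ^ 2 := by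
    ext v
    rw [norm_mul, mul_pow, Complex.norm_real, Real.norm_of_nonneg (Real.sqrt_nonneg _),
      Real.sq_sqrt (hpos v).le, mul_div_cancel_left₀ _ (hpos v).ne']
  refine ⟨⟨?_, ?_, fun x => inner_feature hpos hw x u⟩, ?_⟩
  · exact (Complex.continuous_ofReal.comp_aestronglyMeasurable
      (Real.continuous_sqrt.comp_aestronglyMeasurable hw.aestronglyMeasurable)).mul
      (Lp.aestronglyMeasurable u)
  · rw [h]
    exact (memLp_two_iff_integrable_sq_norm (Lp.aestronglyMeasurable u)).1 (Lp.memLp u)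
  · rw [h, norm_sq_Lp]

/-- Every spectrum of finite weighted norm comes from a coordinate vector in `L²(V)`. -/
theorem IsSpectrum.exists_Lp (hpos : ∀ v, 0 < w v) (hw : Integrable w) {f g : V → ℂ}
    (h : IsSpectrum w f g) : ∃ u : Lp ℂ 2 (volume : Measure V),
      (∀ x, f x = inner ℂ (feature hpos hw x) u) ∧ ‖u‖ ^ 2 = ∫ v, ‖g v‖ ^ 2 / w v := by
  have hn : ∀ v, ‖(√(w v) : ℂ)⁻¹ * g v‖ ^ 2 = ‖g v‖ ^ 2 / w v := fun v => by
    rw [norm_mul, mul_pow, norm_inv, Complex.norm_real, Real.norm_of_nonneg (Real.sqrt_nonneg _),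
      inv_pow, Real.sq_sqrt (hpos v).le, div_eq_inv_mul]
  have hu : MemLp (fun v => (√(w v) : ℂ)⁻¹ * g v) 2 volume := by
    rw [memLp_two_iff_integrable_sq_norm]
    · simpa only [hn] using h.2.1
    · exact ((Complex.continuous_ofReal.comp_aestronglyMeasurable
        (Real.continuous_sqrt.comp_aestronglyMeasurable
          hw.aestronglyMeasurable)).aemeasurable.inv.aestronglyMeasurable).mul h.1
  refine ⟨hu.toLp, fun x => ?_, ?_⟩
  · rw [h.2.2, inner_feature, Real.fourierInv_eq, Real.fourierInv_eq]
    refine integral_congr_ae ?_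
    filter_upwards [hu.coeFn_toLp] with v hv
    have : (√(w v) : ℂ) ≠ 0 := by exact_mod_cast (Real.sqrt_pos.2 (hpos v)).ne'
    rw [hv, mul_inv_cancel_left₀ this]
  · rw [norm_sq_Lp]
    refine integral_congr_ae ?_
    filter_upwards [hu.coeFn_toLp] with v hv
    rw [hv, hn]

theorem rkhsNormSq_nonneg (hpos : ∀ v, 0 < w v) (f : V → ℂ) : 0 ≤ rkhsNormSq w f := by
  refine Real.sInf_nonneg ?_
  rintro _ ⟨g, -, rfl⟩
  exact integral_nonneg fun v => div_nonneg (by positivity) (hpos v).le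

theorem loss_nonneg (hpos : ∀ v, 0 < w v) (X : Ω → V) (Y : Ω → ℂ) {lam : ℝ} (hlam : 0 < lam)
    (f : V → ℂ) : 0 ≤ loss w P X Y lam f := by
  have := rkhsNormSq_nonneg hpos f
  have : 0 ≤ ∫ a, ‖Y a - f (X a)‖ ^ 2 ∂P := integral_nonneg fun a => by positivity
  unfold loss
  positivity

/-- The infimum over functions of the Hilbert space is one over coordinate vectors. As the norm of
a function is itself an infimum over its spectra, this needs no uniqueness of the spectrum. -/
theorem ridgeValue_eq_iInf (hpos : ∀ v, 0 < w v) (hw : Integrable w) (X : Ω → V) (Y : Ω → ℂ)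
    {lam : ℝ} (hlam : 0 < lam) :
    ridgeValue w P X Y lam = ⨅ u : Lp ℂ 2 (volume : Measure V),
      (1 / 2 * (∫ a, ‖Y a - inner ℂ (feature hpos hw (X a)) u‖ ^ 2 ∂P) + lam / 2 * ‖u‖ ^ 2) := by
  have hbdd : BddBelow (Set.range fun u : Lp ℂ 2 (volume : Measure V) =>
      (1 / 2 * (∫ a, ‖Y a - inner ℂ (feature hpos hw (X a)) u‖ ^ 2 ∂P) + lam / 2 * ‖u‖ ^ 2)) := by
    refine ⟨0, ?_⟩
    rintro _ ⟨u, rfl⟩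
    have : 0 ≤ ∫ a, ‖Y a - inner ℂ (feature hpos hw (X a)) u‖ ^ 2 ∂P :=
      integral_nonneg fun a => by positivity
    positivity
  apply le_antisymm
  · refine le_ciInf fun u => ?_
    obtain ⟨hs, hn⟩ := isSpectrum_of_Lp hpos hw u
    have hmem : (fun x => inner ℂ (feature hpos hw x) u) ∈ rkhs w := ⟨_, hs⟩
    refine (csInf_le ⟨0, ?_⟩ (Set.mem_image_of_mem (loss w P X Y lam) hmem)).trans ?_
    · rintro _ ⟨f, -, rfl⟩
      exact loss_nonneg P hpos X Y hlam f
    · have : rkhsNormSq w (fun x => inner ℂ (feature hpos hw x) u) ≤ ‖u‖ ^ 2 := by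
        refine csInf_le ⟨0, ?_⟩ ⟨_, hs, hn.symm⟩
        rintro _ ⟨g, -, rfl⟩
        exact integral_nonneg fun v => div_nonneg (by positivity) (hpos v).le
      unfold loss
      gcongr
  · have hmem : (fun x => inner ℂ (feature hpos hw x) 0) ∈ rkhs w :=
      ⟨_, (isSpectrum_of_Lp hpos hw 0).1⟩
    refine le_csInf ⟨_, Set.mem_image_of_mem (loss w P X Y lam) hmem⟩ ?_
    rintro _ ⟨f, ⟨g₀, hg₀⟩, rfl⟩
    suffices key : ∀ m : ℝ, (∀ u : Lp ℂ 2 (volume : Measure V), m ≤ 1 / 2 *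
        (∫ a, ‖Y a - inner ℂ (feature hpos hw (X a)) u‖ ^ 2 ∂P) + lam / 2 * ‖u‖ ^ 2) →
        m ≤ loss w P X Y lam f from key _ fun u => ciInf_le hbdd u
    intro m hm
    have h : (m - 1 / 2 * ∫ a, ‖Y a - f (X a)‖ ^ 2 ∂P) / (lam / 2) ≤ rkhsNormSq w f := by
      refine le_csInf ⟨_, g₀, hg₀, rfl⟩ ?_
      rintro _ ⟨g, hg, rfl⟩
      obtain ⟨u, hfu, hu⟩ := hg.exists_Lp hpos hw
      rw [div_le_iff₀ (half_pos hlam), sub_le_iff_le_add', ← hu, mul_comm (‖u‖ ^ 2)]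
      simp only [hfu]
      exact hm u
    rw [div_le_iff₀ (half_pos hlam)] at h
    unfold loss
    linarith

theorem ridgeValue_congr_ae {X X' : Ω → V} (h : X =ᵐ[P] X') (Y : Ω → ℂ) (lam : ℝ) :
    ridgeValue w P X Y lam = ridgeValue w P X' Y lam := by
  have : loss w P X Y lam = loss w P X' Y lam := by
    ext f
    unfold loss
    congr 2
    refine integral_congr_ae ?_
    filter_upwards [h] with a ha
    rw [ha]
  rw [ridgeValue, ridgeValue, this]

variable [IsProbabilityMeasure P]

theorem ridgeValue_eq_dualValue (hpos : ∀ v, 0 < w v) (hw : Integrable w) {X : Ω → V}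
    (hX : Measurable X) {Y : Ω → ℂ} (hY : MemLp Y 2 P) {lam : ℝ} (hlam : 0 < lam) :
    ridgeValue w P X Y lam = dualValue hY.toLp lam (kernelForm P X (weightKernel w)) := by
  rw [ridgeValue_eq_iInf P hpos hw X Y hlam]
  exact iInf_ridge_eq_dualValue P hX (continuous_feature hpos hw) (norm_feature_le hpos hw)
    (inner_feature_feature hpos hw) (continuous_weightKernel hw).measurable hY hlam

theorem kernelForm_weightKernel_nonneg (hpos : ∀ v, 0 < w v) (hw : Integrable w) {X : Ω → V}
    (hX : Measurable X) (g : Lp ℂ 2 P) : 0 ≤ kernelForm P X (weightKernel w) g := by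
  rw [← norm_sq_adjoint_evalOp P hX (continuous_feature hpos hw) (norm_feature_le hpos hw)
    (inner_feature_feature hpos hw) (continuous_weightKernel hw).measurable]
  positivity

end Feature

/-! ### Radial weights and inner products -/

section Forms

variable {V : Type*} [NormedAddCommGroup V] [InnerProductSpace ℝ V] [FiniteDimensional ℝ V]

open scoped MatrixOrder in
/-- `A` comes from a factorization `BᵀB` of the positive definite matrix of `S`. -/
theorem IsInnerProduct.exists_gram {S : LinearMap.BilinForm ℝ V} (hS : IsInnerProduct S) :
    ∃ A : V ≃ₗ[ℝ] V, S = gram A := by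
  classical
  set b := stdOrthonormalBasis ℝ V
  set M := LinearMap.BilinForm.toMatrix b.toBasis S
  have hMS : ∀ i j, M i j = S (b i) (b j) := fun i j => by
    simp only [M, LinearMap.BilinForm.toMatrix_apply, OrthonormalBasis.coe_toBasis]
  have hM : M.PosSemidef := by
    refine Matrix.PosSemidef.of_dotProduct_mulVec_nonneg ?_ fun x => ?_
    · ext i j
      rw [Matrix.conjTranspose_apply, hMS, hMS, star_trivial]
      exact hS.1.eq _ _
    · have h := hS.isPosSemidef.isNonneg.nonneg (∑ i, x i • b i)
      have hx : star x ⬝ᵥ M.mulVec x = S (∑ i, x i • b i) (∑ i, x i • b i) := by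
        simp [hMS, dotProduct, Matrix.mulVec, Finset.mul_sum, LinearMap.sum_apply, mul_comm]
        exact Finset.sum_congr rfl fun i _ => Finset.sum_congr rfl fun j _ => by
          rw [hS.1.eq (b i)]
      exact hx ▸ h
  obtain ⟨B, hB⟩ := CStarAlgebra.nonneg_iff_eq_star_mul_self.1 hM.nonneg
  set A : V →ₗ[ℝ] V := Matrix.toLin b.toBasis b.toBasis B
  have hSA : S = gram A := by
    refine b.toBasis.ext fun i => b.toBasis.ext fun j => ?_
    have h := congrFun (congrFun hB i) j
    rw [hMS] at h
    rw [OrthonormalBasis.coe_toBasis, h, ← OrthonormalBasis.coe_toBasis, gram_apply,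
      Matrix.toLin_self, Matrix.toLin_self]
    simp [Matrix.mul_apply, sum_inner, inner_sum, inner_smul_left, inner_smul_right,
      b.inner_eq_ite, mul_comm]
  have hinj : Function.Injective A := by
    rw [injective_iff_map_eq_zero]
    intro x hx
    by_contra hne
    have := hS.2 x hne
    rw [hSA, gram_apply, hx, inner_zero_left] at this
    exact this.false
  exact ⟨LinearEquiv.ofInjectiveEndo A hinj, hSA⟩

theorem formDet_gram (A : V →ₗ[ℝ] V) : formDet (gram A) = LinearMap.det A ^ 2 := by
  have h := LinearMap.normDet_sq_eq_det_gram A (stdOrthonormalBasis ℝ V)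
  rw [LinearMap.normDet_eq_abs_det, sq_abs] at h
  exact h.symm

theorem det_adjoint (A : V →ₗ[ℝ] V) : LinearMap.det A.adjoint = LinearMap.det A := by
  classical
  set b := stdOrthonormalBasis ℝ V
  rw [← LinearMap.det_toMatrix b.toBasis, ← LinearMap.det_toMatrix b.toBasis,
    LinearMap.toMatrix_adjoint]
  simp [Matrix.det_transpose]

/-- For the inner product `AᵀA`, the dual norm of `Aᵀ v` is the background norm of `v`. -/
theorem dualNorm_gram (A : V ≃ₗ[ℝ] V) (v : V) :
    dualNorm (gram A) (LinearMap.adjoint (A : V →ₗ[ℝ] V) v) = ‖v‖ := by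
  have hset : {t | ∃ x : V, gram A x x = 1 ∧ t = inner ℝ (LinearMap.adjoint (A : V →ₗ[ℝ] V) v) x} =
      {t | ∃ y : V, ‖y‖ = 1 ∧ t = inner ℝ v y} := by
    ext t
    constructor
    · rintro ⟨x, hx, rfl⟩
      refine ⟨A x, ?_, LinearMap.adjoint_inner_left _ _ _⟩
      rw [gram_apply, real_inner_self_eq_norm_sq] at hx
      exact (pow_eq_one_iff_of_nonneg (norm_nonneg _) two_ne_zero).1 hx
    · rintro ⟨y, hy, rfl⟩
      refine ⟨A.symm y, ?_, ?_⟩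
      · simp [gram_apply, hy]
      · simp [LinearMap.adjoint_inner_left]
  rw [dualNorm, hset]
  -- `‖v‖` is attained at `v / ‖v‖`. If `V = 0` the set is empty and its `sSup` is `0 = ‖v‖`.
  apply le_antisymm
  · refine Real.sSup_le ?_ (norm_nonneg v)
    rintro _ ⟨y, hy, rfl⟩
    simpa [hy] using real_inner_le_norm v y
  · rcases eq_or_ne v 0 with rfl | hv
    · rw [norm_zero]
      refine Real.sSup_nonneg ?_
      rintro _ ⟨y, -, rfl⟩
      simp
    · refine le_csSup ⟨‖v‖, ?_⟩ ⟨‖v‖⁻¹ • v, norm_smul_inv_norm hv, ?_⟩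
      · rintro _ ⟨y, hy, rfl⟩
        simpa [hy] using real_inner_le_norm v y
      · rw [inner_smul_right, real_inner_self_eq_norm_sq]
        field_simp

theorem formWeight_gram_adjoint (k : ℝ → ℝ) (A : V ≃ₗ[ℝ] V) (v : V) :
    formWeight k (gram A) (LinearMap.adjoint (A : V →ₗ[ℝ] V) v) =
      radialWeight k v / |LinearMap.det (A : V →ₗ[ℝ] V)| := by
  rw [formWeight, dualNorm_gram, formDet_gram, Real.sqrt_sq_eq_abs, radialWeight]

/-- The transpose of a linear automorphism. -/
def adjointEquiv (A : V ≃ₗ[ℝ] V) : V ≃ₗ[ℝ] V :=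
  LinearEquiv.ofIsUnitDet (f := LinearMap.adjoint (A : V →ₗ[ℝ] V))
    (v := (stdOrthonormalBasis ℝ V).toBasis) (v' := (stdOrthonormalBasis ℝ V).toBasis) (by
      rw [LinearMap.det_toMatrix, det_adjoint]
      exact LinearEquiv.isUnit_det' A)

theorem adjointEquiv_apply (A : V ≃ₗ[ℝ] V) (v : V) :
    adjointEquiv A v = LinearMap.adjoint (A : V →ₗ[ℝ] V) v := rfl

theorem formWeight_pos {k : ℝ → ℝ} (hk : ∀ r, 0 ≤ r → 0 < k r) (A : V ≃ₗ[ℝ] V) (v : V) :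
    0 < formWeight k (gram A) v := by
  have hd : 0 < |LinearMap.det (A : V →ₗ[ℝ] V)| := abs_pos.2 (LinearEquiv.isUnit_det' A).ne_zero
  rw [formWeight, formDet_gram, Real.sqrt_sq_eq_abs]
  exact div_pos (hk _ (sq_nonneg _)) hd

end Forms

section Radial

variable {V : Type*} [NormedAddCommGroup V] [InnerProductSpace ℝ V] [FiniteDimensional ℝ V]
  [MeasurableSpace V] [BorelSpace V]

/-- The kernel of a radial weight is invariant under isometries, and a reflection takes `x` to
`y`. -/
theorem weightKernel_radialWeight_eq_of_norm_eq (k : ℝ → ℝ) {x y : V} (h : ‖x‖ = ‖y‖) :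
    weightKernel (radialWeight k) x = weightKernel (radialWeight k) y := by
  have hA := Real.fourierInv_comp_linearIsometry (ℝ ∙ (x - y))ᗮ.reflection
    (fun v : V => ((radialWeight k v : ℝ) : ℂ)) x
  have hf : (fun v : V => ((radialWeight k v : ℝ) : ℂ)) ∘ (ℝ ∙ (x - y))ᗮ.reflection =
      fun v => ((radialWeight k v : ℝ) : ℂ) := by
    funext v
    simp [radialWeight]
  rwa [Submodule.reflection_sub h, hf] at hA

/-- The kernel of a radial weight is a continuous function of the squared norm. It vanishes at
infinity by the Riemann-Lebesgue lemma, provided that `V` is unbounded. -/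
theorem exists_profile (k : ℝ → ℝ) (hw : Integrable (radialWeight k : V → ℝ)) :
    ∃ κ : ℝ → ℂ, Continuous κ ∧ (∃ C, ∀ t, ‖κ t‖ ≤ C) ∧ (Nontrivial V → Tendsto κ atTop (𝓝 0)) ∧
      ∀ z : V, weightKernel (radialWeight k) z = κ (‖z‖ ^ 2) := by
  -- `e` is a unit vector, or zero if `V = 0`; the profile is the kernel along the ray of `e`.
  obtain ⟨e, he, he'⟩ : ∃ e : V, (∀ z : V, ‖‖z‖ • e‖ = ‖z‖) ∧ (Nontrivial V → ‖e‖ = 1) := by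
    rcases subsingleton_or_nontrivial V with h | h
    · exact ⟨0, fun z => by simp [Subsingleton.elim z 0], fun h' => absurd h (not_subsingleton V)⟩
    · obtain ⟨e, he⟩ := exists_norm_eq V zero_le_one
      exact ⟨e, fun z => by simp [norm_smul, he], fun _ => he⟩
  refine ⟨fun t => weightKernel (radialWeight k) (√t • e),
    (continuous_weightKernel hw).comp (by fun_prop), ⟨_, fun t => norm_weightKernel_le _ _⟩,
    fun hV => (tendsto_weightKernel_cocompact _).comp ?_, fun z => ?_⟩
  · rw [← Metric.cobounded_eq_cocompact, ← tendsto_norm_atTop_iff_cobounded]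
    simpa [norm_smul, he' hV, abs_of_nonneg (Real.sqrt_nonneg _)] using Real.tendsto_sqrt_atTop
  · simp only [Real.sqrt_sq (norm_nonneg z)]
    exact weightKernel_radialWeight_eq_of_norm_eq k (he z).symm

theorem map_adjointEquiv_volume (A : V ≃ₗ[ℝ] V) :
    (volume : Measure V).map (adjointEquiv A) =
      ENNReal.ofReal |(LinearMap.det (A : V →ₗ[ℝ] V))⁻¹| • volume := by
  have h := Measure.map_linearMap_addHaar_eq_smul_addHaar (volume : Measure V)
    (f := LinearMap.adjoint (A : V →ₗ[ℝ] V))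
    (by rw [det_adjoint]; exact (LinearEquiv.isUnit_det' A).ne_zero)
  rwa [det_adjoint] at h

theorem integrable_formWeight {k : ℝ → ℝ} (hw : Integrable (radialWeight k : V → ℝ))
    (A : V ≃ₗ[ℝ] V) : Integrable (formWeight k (gram A) : V → ℝ) := by
  have hd : 0 < |(LinearMap.det (A : V →ₗ[ℝ] V))⁻¹| :=
    abs_pos.2 (inv_ne_zero (LinearEquiv.isUnit_det' A).ne_zero)
  have he : MeasurableEmbedding (adjointEquiv A) :=
    (adjointEquiv A).toContinuousLinearEquiv.toHomeomorph.measurableEmbedding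
  have h : Integrable (formWeight k (gram A) : V → ℝ)
      ((volume : Measure V).map (adjointEquiv A)) := by
    rw [he.integrable_map_iff]
    exact (hw.div_const _).congr (ae_of_all _ fun v => (formWeight_gram_adjoint k A v).symm)
  rw [map_adjointEquiv_volume] at h
  exact (integrable_smul_measure (ENNReal.ofReal_pos.2 hd).ne' ENNReal.ofReal_ne_top).1 h

/-- The change of variables `ω = Aᵀ v` turns the kernel of `ℋ_S` for `S = AᵀA` into the radial
kernel composed with `A`. -/
theorem weightKernel_formWeight (k : ℝ → ℝ) (A : V ≃ₗ[ℝ] V) (z : V) :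
    weightKernel (formWeight k (gram A)) z = weightKernel (radialWeight k) (A z) := by
  have hd : LinearMap.det (A : V →ₗ[ℝ] V) ≠ 0 := (LinearEquiv.isUnit_det' A).ne_zero
  have hd' : (|LinearMap.det (A : V →ₗ[ℝ] V)| : ℝ) ≠ 0 := abs_ne_zero.2 hd
  have he : MeasurableEmbedding (adjointEquiv A) :=
    (adjointEquiv A).toContinuousLinearEquiv.toHomeomorph.measurableEmbedding
  have h := he.integral_map (μ := volume)
    (fun v => Real.fourierChar (inner ℝ v z) • (formWeight k (gram A) v : ℂ))
  rw [map_adjointEquiv_volume, integral_smul_measure, ENNReal.toReal_ofReal (abs_nonneg _)] at h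
  rw [weightKernel, weightKernel, Real.fourierInv_eq, Real.fourierInv_eq]
  have h2 : ∀ v, Real.fourierChar (inner ℝ (adjointEquiv A v) z) •
      (formWeight k (gram A) (adjointEquiv A v) : ℂ) =
      (|LinearMap.det (A : V →ₗ[ℝ] V)|⁻¹ : ℝ) •
        (Real.fourierChar (inner ℝ v (A z)) • (radialWeight k v : ℂ)) := fun v => by
    rw [adjointEquiv_apply, formWeight_gram_adjoint, LinearMap.adjoint_inner_left, smul_comm,
      div_eq_inv_mul, Complex.ofReal_mul, ← smul_eq_mul, Complex.real_smul]
    rfl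
  simp only [h2, integral_smul, abs_inv] at h
  exact smul_right_injective ℂ (inv_ne_zero hd') h

end Radial

/-! ### The kernel at a point of the partial compactification -/

namespace PartialCompactification

variable {V : Type*} [NormedAddCommGroup V] [InnerProductSpace ℝ V]

theorem ConvergesTo.tendsto_form {q : ℕ → PartialCompactification V}
    {p : PartialCompactification V} (h : ConvergesTo q p) {z : V} (hz : z ∈ p.dom) :
    Tendsto (fun i => (q i).form ⟨z, h.1 i hz⟩ ⟨z, h.1 i hz⟩) atTop
      (𝓝 (p.form ⟨z, hz⟩ ⟨z, hz⟩)) := by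
  obtain ⟨hle, hform, -⟩ := h
  exact hform ⟨z, hz⟩ ⟨z, hz⟩

instance nonempty_quotientSq_index (p : PartialCompactification V) (W : Submodule ℝ V) :
    Nonempty {u : p.dom // (u : V) ∈ W} := ⟨⟨0, W.zero_mem⟩⟩

theorem quotientSq_le (p : PartialCompactification V) (W : Submodule ℝ V) (x : p.dom) :
    p.quotientSq W x ≤ p.form x x := by
  have h0 : ((0 : p.dom) : V) ∈ W := by simp
  refine (ciInf_le ⟨0, ?_⟩ (⟨0, h0⟩ : {u : p.dom // (u : V) ∈ W})).trans (by simp)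
  rintro _ ⟨u, rfl⟩
  exact p.isPosSemidef.isNonneg.nonneg _

/-- A function on the partial compactification is continuous if it is sequentially continuous for
the defining convergence of sequences. -/
theorem continuous_of_tendsto {f : PartialCompactification V → ℝ}
    (h : ∀ q p, ConvergesTo q p → Tendsto (fun i => f (q i)) atTop (𝓝 (f p))) : Continuous f :=
  continuous_def.2 fun _ hs q p hqp hp => (h q p hqp).eventually (hs.mem_nhds hp)

variable [FiniteDimensional ℝ V]

/-- The translation-invariant kernel of a point `(W, Σ_W)`, for a radial profile `κ`: on `W` it is
`κ` of the form `Σ_W`, and off `W`, where the limiting forms are infinite, it vanishes. The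
orthogonal projection to `W` serves to write the form as a function on `V`. -/
def profileKernel (κ : ℝ → ℂ) (p : PartialCompactification V) : V → ℂ :=
  Set.indicator p.dom fun z =>
    κ (p.form (p.dom.orthogonalProjectionOnto z) (p.dom.orthogonalProjectionOnto z))

theorem profileKernel_of_mem (κ : ℝ → ℂ) {p : PartialCompactification V} {z : V}
    (hz : z ∈ p.dom) : profileKernel κ p z = κ (p.form ⟨z, hz⟩ ⟨z, hz⟩) := by
  have h : p.dom.orthogonalProjectionOnto z = ⟨z, hz⟩ :=
    p.dom.orthogonalProjectionOnto_mem_subspace_eq_self ⟨z, hz⟩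
  rw [profileKernel, Set.indicator_of_mem (by exact hz), h]

theorem profileKernel_of_notMem (κ : ℝ → ℂ) {p : PartialCompactification V} {z : V}
    (hz : z ∉ p.dom) : profileKernel κ p z = 0 :=
  Set.indicator_of_notMem (by exact hz) _

theorem profileKernel_ofForm (κ : ℝ → ℂ) (S : LinearMap.BilinForm ℝ V) (hS : S.IsPosSemidef)
    (z : V) : profileKernel κ (ofForm S hS) z = κ (S z z) :=
  profileKernel_of_mem κ (p := ofForm S hS) (z := z) Submodule.mem_top

theorem norm_profileKernel_le {κ : ℝ → ℂ} {C : ℝ} (hC : ∀ t, ‖κ t‖ ≤ C)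
    (p : PartialCompactification V) (z : V) : ‖profileKernel κ p z‖ ≤ C := by
  by_cases hz : z ∈ p.dom
  · rw [profileKernel_of_mem κ hz]
    exact hC _
  · rw [profileKernel_of_notMem κ hz, norm_zero]
    exact (norm_nonneg _).trans (hC 0)

theorem measurable_profileKernel [MeasurableSpace V] [BorelSpace V] {κ : ℝ → ℂ}
    (hκ : Continuous κ) (p : PartialCompactification V) : Measurable (profileKernel κ p) := by
  have hB : Continuous fun w : p.dom => p.form w w := by
    have h : Continuous fun w : p.dom => p.form.toContinuousBilinearMap w w := by fun_prop
    exact h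
  refine Measurable.indicator ?_ p.dom.closed_of_finiteDimensional.measurableSet
  exact (hκ.comp (hB.comp p.dom.orthogonalProjectionOnto.continuous)).measurable

/-- Off `W` the forms of a sequence converging to `(W, Σ_W)` tend to infinity, since they dominate
their quotients modulo `W`; there the kernels tend to zero with the profile. -/
theorem ConvergesTo.tendsto_profileKernel {κ : ℝ → ℂ} (hκ : Continuous κ)
    (hκ0 : Nontrivial V → Tendsto κ atTop (𝓝 0)) {q : ℕ → PartialCompactification V}
    {p : PartialCompactification V} (h : ConvergesTo q p) (z : V) :
    Tendsto (fun i => profileKernel κ (q i) z) atTop (𝓝 (profileKernel κ p z)) := by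
  by_cases hz : z ∈ p.dom
  · rw [profileKernel_of_mem κ hz]
    refine ((hκ.tendsto _).comp (h.tendsto_form hz)).congr fun i => ?_
    rw [profileKernel_of_mem κ (h.1 i hz), Function.comp_apply]
  · rw [profileKernel_of_notMem κ hz]
    obtain ⟨-, -, L, hL, hbound⟩ := h
    have hV : Nontrivial V := ⟨z, 0, fun h0 => hz (h0 ▸ p.dom.zero_mem)⟩
    have hpos : 0 < ‖p.dom.mkQ z‖ ^ 2 := by
      have : p.dom.mkQ z ≠ 0 := by simpa using hz
      have := p.dom.closed_of_finiteDimensional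
      positivity
    have htop : Tendsto (fun i => L i ^ 2 * ‖p.dom.mkQ z‖ ^ 2) atTop atTop :=
      ((tendsto_pow_atTop two_ne_zero).comp hL).atTop_mul_const hpos
    -- Some `(q i).dom` may contain `z` and others not; either way the kernel at `z` is small.
    rw [Metric.tendsto_nhds]
    intro ε hε
    obtain ⟨T, hT⟩ := eventually_atTop.1 (Metric.tendsto_nhds.1 (hκ0 hV) ε hε)
    filter_upwards [htop.eventually_ge_atTop T] with i hi
    by_cases hzi : z ∈ (q i).dom
    · rw [profileKernel_of_mem κ hzi]
      exact hT _ (hi.trans ((hbound i ⟨z, hzi⟩).trans (quotientSq_le _ _ _)))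
    · rwa [profileKernel_of_notMem κ hzi, dist_self]

/-- The inner product `Σ_W(Px, Py) + ε ⟨x, y⟩ + Λ ⟨x - Px, y - Py⟩`, where `P` is the orthogonal
projection to `W`. -/
def regularization (p : PartialCompactification V) (ε Λ : ℝ) : LinearMap.BilinForm ℝ V :=
  p.form.compl₁₂ p.dom.orthogonalProjectionOnto.toLinearMap
      p.dom.orthogonalProjectionOnto.toLinearMap +
    ε • innerₗ V + Λ • gram (LinearMap.id - p.dom.starProjection.toLinearMap)

theorem regularization_apply (p : PartialCompactification V) (ε Λ : ℝ) (x y : V) :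
    p.regularization ε Λ x y =
      p.form (p.dom.orthogonalProjectionOnto x) (p.dom.orthogonalProjectionOnto y) +
        ε * inner ℝ x y +
        Λ * inner ℝ (x - p.dom.starProjection x) (y - p.dom.starProjection y) := rfl

theorem regularization_isInnerProduct (p : PartialCompactification V) {ε Λ : ℝ} (hε : 0 < ε)
    (hΛ : 0 ≤ Λ) : IsInnerProduct (p.regularization ε Λ) := by
  refine ⟨⟨fun x y => ?_⟩, fun x hx => ?_⟩
  · rw [regularization_apply, regularization_apply, p.isPosSemidef.isSymm.eq,
      real_inner_comm, real_inner_comm (x - _)]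
  · rw [regularization_apply, real_inner_self_eq_norm_sq, real_inner_self_eq_norm_sq]
    have h1 := p.isPosSemidef.isNonneg.nonneg (p.dom.orthogonalProjectionOnto x)
    have h2 : 0 < ‖x‖ := norm_pos_iff.2 hx
    positivity

/-- Inner products are dense: `(W, Σ_W)` is the limit of its regularizations with `ε = 1 / (i + 1)`
and `Λ = i`. -/
theorem convergesTo_regularization (p : PartialCompactification V) :
    ConvergesTo (fun i : ℕ => ofForm (p.regularization (1 / ((i : ℝ) + 1)) i)
      (p.regularization_isInnerProduct Nat.one_div_pos_of_nat i.cast_nonneg).isPosSemidef) p := by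
  refine ⟨fun i => le_top, fun x y => ?_, fun i => √i,
    Real.tendsto_sqrt_atTop.comp tendsto_natCast_atTop_atTop, fun i x => ?_⟩
  · have h : ∀ i : ℕ, p.regularization (1 / ((i : ℝ) + 1)) i x y =
        p.form x y + 1 / ((i : ℝ) + 1) * inner ℝ (x : V) y := fun i => by
      simp [regularization_apply]
    have hlim := (tendsto_one_div_add_atTop_nhds_zero_nat (𝕜 := ℝ)).mul_const
      (inner ℝ (x : V) (y : V))
    rw [zero_mul] at hlim
    have hsum := (hlim.const_add (p.form x y)).congr fun i => (h i).symm
    rw [add_zero] at hsum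
    exact hsum
  · rw [Real.sq_sqrt i.cast_nonneg]
    refine le_ciInf fun u => ?_
    change _ ≤ p.regularization _ _ ((x : V) + (u : V)) ((x : V) + (u : V))
    have hu : p.dom.starProjection (u : V) = u := Submodule.starProjection_eq_self_iff.2 u.2
    have hmk : p.dom.mkQ (x : V) = p.dom.mkQ (x - p.dom.starProjection (x : V)) := by
      rw [map_sub, Submodule.mkQ_apply p.dom (p.dom.starProjection (x : V)),
        (Submodule.Quotient.mk_eq_zero _).2 (p.dom.starProjection_apply_mem _), sub_zero]
    have hn : ‖p.dom.mkQ (x : V)‖ ≤ ‖(x : V) - p.dom.starProjection (x : V)‖ := by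
      rw [hmk]
      exact Submodule.Quotient.norm_mk_le _ _
    have h1 := p.isPosSemidef.isNonneg.nonneg (p.dom.orthogonalProjectionOnto ((x : V) + (u : V)))
    have h2 : 0 ≤ 1 / ((i : ℝ) + 1) * ‖(x : V) + (u : V)‖ ^ 2 := by positivity
    have h3 : (i : ℝ) * ‖p.dom.mkQ (x : V)‖ ^ 2 ≤
        i * ‖(x : V) - p.dom.starProjection (x : V)‖ ^ 2 := by gcongr
    rw [regularization_apply, map_add p.dom.starProjection, hu, add_sub_add_right_eq_sub,
      real_inner_self_eq_norm_sq, real_inner_self_eq_norm_sq]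
    linarith

/-- Continuous functions on the partial compactification are determined by their values at inner
products. -/
theorem eq_of_eq_on_innerProducts {f g : PartialCompactification V → ℝ} (hf : Continuous f)
    (hg : Continuous g) (h : ∀ (S : LinearMap.BilinForm ℝ V) (hS : IsInnerProduct S),
      f (ofForm S hS.isPosSemidef) = g (ofForm S hS.isPosSemidef)) : f = g := by
  funext p
  have hp := p.convergesTo_regularization.tendsto
  refine tendsto_nhds_unique ((hf.tendsto p).comp hp) (((hg.tendsto p).comp hp).congr fun i => ?_)
  exact (h _ (p.regularization_isInnerProduct Nat.one_div_pos_of_nat i.cast_nonneg)).symm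

end PartialCompactification

/-! ### Ridge values as dual values, and their continuity -/

section RidgeValue

variable {V : Type*} [NormedAddCommGroup V] [InnerProductSpace ℝ V] [FiniteDimensional ℝ V]
  [MeasurableSpace V] [BorelSpace V] {Ω : Type*} [MeasurableSpace Ω] (P : Measure Ω)
  [IsProbabilityMeasure P] {X : Ω → V} {k : ℝ → ℝ} {κ : ℝ → ℂ}

open PartialCompactification

theorem weightKernel_formWeight_eq_profileKernel
    (hprof : ∀ z : V, weightKernel (radialWeight k) z = κ (‖z‖ ^ 2)) (A : V ≃ₗ[ℝ] V)
    (hS : (gram (A : V →ₗ[ℝ] V)).IsPosSemidef) :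
    weightKernel (formWeight k (gram A)) = profileKernel κ (ofForm (gram (A : V →ₗ[ℝ] V)) hS) := by
  ext z
  rw [weightKernel_formWeight, hprof, profileKernel_ofForm, gram_apply, real_inner_self_eq_norm_sq]
  rfl

theorem calJ_eq_dualValue (hX : Measurable X) {Y : Ω → ℂ} (hY : MemLp Y 2 P)
    (hk : ∀ r, 0 ≤ r → 0 < k r) (hw : Integrable (radialWeight k : V → ℝ))
    (hprof : ∀ z : V, weightKernel (radialWeight k) z = κ (‖z‖ ^ 2)) {lam : ℝ} (hlam : 0 < lam)
    (S : LinearMap.BilinForm ℝ V) (hS : IsInnerProduct S) :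
    calJ k P X Y lam S = dualValue hY.toLp lam
      (kernelForm P X (profileKernel κ (ofForm S hS.isPosSemidef))) := by
  obtain ⟨A, rfl⟩ := hS.exists_gram
  rw [calJ, ridgeValue_eq_dualValue P (formWeight_pos hk A) (integrable_formWeight hw A) hX hY hlam,
    weightKernel_formWeight_eq_profileKernel hprof A hS.isPosSemidef]

theorem J_eq_dualValue (hX : Measurable X) {Y : Ω → ℂ} (hY : MemLp Y 2 P)
    (hk : ∀ r, 0 ≤ r → 0 < k r) (hw : Integrable (radialWeight k : V → ℝ))
    (hprof : ∀ z : V, weightKernel (radialWeight k) z = κ (‖z‖ ^ 2)) {lam : ℝ} (hlam : 0 < lam)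
    (U : V →ₗ[ℝ] V) :
    J k P X Y lam U = dualValue hY.toLp lam
      (kernelForm P X (profileKernel κ (ofForm (gram U) (gram_isPosSemidef U)))) := by
  have hU : Measurable fun a => U (X a) :=
    U.continuous_of_finiteDimensional.measurable.comp hX
  have hpos : ∀ v : V, 0 < radialWeight k v := fun v => hk _ (sq_nonneg ‖v‖)
  rw [J, ridgeValue_eq_dualValue P hpos hw hU hY hlam]
  congr 1
  ext g
  simp only [kernelForm, ← map_sub, hprof, profileKernel_ofForm, gram_apply,
    real_inner_self_eq_norm_sq]

/-- The kernel of any point of the partial compactification is positive semidefinite, as a limit of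
the reproducing kernels of inner products. -/
theorem kernelForm_profileKernel_nonneg (hX : Measurable X) (hk : ∀ r, 0 ≤ r → 0 < k r)
    (hw : Integrable (radialWeight k : V → ℝ))
    (hprof : ∀ z : V, weightKernel (radialWeight k) z = κ (‖z‖ ^ 2)) (hκ : Continuous κ) {C : ℝ}
    (hC : ∀ t, ‖κ t‖ ≤ C) (hκ0 : Nontrivial V → Tendsto κ atTop (𝓝 0))
    (p : PartialCompactification V) (g : Lp ℂ 2 P) :
    0 ≤ kernelForm P X (profileKernel κ p) g := by
  refine kernelForm_nonneg_of_tendsto P hX (fun i => measurable_profileKernel hκ _)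
    (fun i => norm_profileKernel_le hC _)
    (p.convergesTo_regularization.tendsto_profileKernel hκ hκ0) g fun i => ?_
  have hS := p.regularization_isInnerProduct (Nat.one_div_pos_of_nat (n := i) (α := ℝ))
    (i.cast_nonneg (α := ℝ))
  obtain ⟨A, hA⟩ := hS.exists_gram
  have h := kernelForm_weightKernel_nonneg P (formWeight_pos hk A) (integrable_formWeight hw A) hX g
  rw [weightKernel_formWeight_eq_profileKernel hprof A (gram_isPosSemidef _)] at h
  simpa only [hA] using h

theorem continuous_dualValue_profileKernel (hX : Measurable X) (y : Lp ℂ 2 P)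
    (hk : ∀ r, 0 ≤ r → 0 < k r) (hw : Integrable (radialWeight k : V → ℝ))
    (hprof : ∀ z : V, weightKernel (radialWeight k) z = κ (‖z‖ ^ 2)) (hκ : Continuous κ) {C : ℝ}
    (hC : ∀ t, ‖κ t‖ ≤ C) (hκ0 : Nontrivial V → Tendsto κ atTop (𝓝 0)) {lam : ℝ}
    (hlam : 0 < lam) :
    Continuous fun p : PartialCompactification V =>
      dualValue y lam (kernelForm P X (profileKernel κ p)) := by
  have hpos := kernelForm_profileKernel_nonneg P hX hk hw hprof hκ hC hκ0
  exact continuous_of_tendsto fun q p hqp => tendsto_dualValue_kernelForm P hX y hlam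
    (fun i => measurable_profileKernel hκ _) (measurable_profileKernel hκ _)
    (fun i => norm_profileKernel_le hC _) (norm_profileKernel_le hC _) (fun i => hpos _) (hpos _)
    (hqp.tendsto_profileKernel hκ hκ0)

end RidgeValue

end KernelRidge

end

open KernelRidge in
theorem mainTheorem10
    {V : Type*} [NormedAddCommGroup V] [InnerProductSpace ℝ V] [FiniteDimensional ℝ V]
    [MeasurableSpace V] [BorelSpace V]
    {Ω : Type*} [MeasurableSpace Ω] (P : MeasureTheory.Measure Ω)
    [MeasureTheory.IsProbabilityMeasure P]
    (X : Ω → V) (hX : AEMeasurable X P) (Y : Ω → ℂ) (hY : MeasureTheory.MemLp Y 2 P)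
    (k : ℝ → ℝ) (hk_pos : ∀ r, 0 ≤ r → 0 < k r)
    (hk_int : MeasureTheory.Integrable (fun ω : V => k (‖ω‖ ^ 2)) MeasureTheory.volume)
    (hk_one : ∫ ω : V, k (‖ω‖ ^ 2) = 1)
    (lam : ℝ) (hlam : 0 < lam) :
    ∃! Jbar : PartialCompactification V → ℝ,
      Continuous Jbar ∧
      (∀ (S : LinearMap.BilinForm ℝ V) (hS : IsInnerProduct S),
        Jbar (PartialCompactification.ofForm S hS.isPosSemidef) = calJ k P X Y lam S) ∧
      ∀ U : V →ₗ[ℝ] V,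
        Jbar (PartialCompactification.ofForm (gram U) (gram_isPosSemidef U)) =
          J k P X Y lam U := by
  obtain ⟨κ, hκ, ⟨C, hC⟩, hκ0, hprof⟩ := exists_profile k hk_int
  -- The kernel operators are built from a measurable version of `X`, which has the same losses.
  have hXm := hX.measurable_mk
  refine ⟨fun p => dualValue hY.toLp lam
    (kernelForm P (hX.mk X) (PartialCompactification.profileKernel κ p)),
    ⟨continuous_dualValue_profileKernel P hXm _ hk_pos hk_int hprof hκ hC hκ0 hlam,
      fun S hS => ?_, fun U => ?_⟩, ?_⟩
  · rw [calJ, ridgeValue_congr_ae P hX.ae_eq_mk]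
    exact (calJ_eq_dualValue P hXm hY hk_pos hk_int hprof hlam S hS).symm
  · have h : (fun a => U (X a)) =ᵐ[P] fun a => U (hX.mk X a) := hX.ae_eq_mk.fun_comp U
    rw [J, ridgeValue_congr_ae P h]
    exact (J_eq_dualValue P hXm hY hk_pos hk_int hprof hlam U).symm
  · rintro f ⟨hf, hfS, -⟩
    refine PartialCompactification.eq_of_eq_on_innerProducts hf
      (continuous_dualValue_profileKernel P hXm _ hk_pos hk_int hprof hκ hC hκ0 hlam)
      fun S hS => ?_
    rw [hfS S hS, calJ, ridgeValue_congr_ae P hX.ae_eq_mk]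
    exact calJ_eq_dualValue P hXm hY hk_pos hk_int hprof hlam S hS
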